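/- Let $H$ be an $N$-dimensional complex Hilbert space and let $k\ge 1$. For a linear operator $T$ on $H$, let $\lambda_1,\dots,\lambda_N$ be its eigenvalues, listed with multiplicity, and let $\operatorname{spec}(T)$ denote this multiset. - $\Lambda_k(T)$ is the set of all $\lambda\in\mathbb{C}$ such that $PTP=\lambda P$ for some orthogonal projection $P$ on $H$ of rank $k$. - $\Omega_k(T)=\bigcap_{\Gamma}\operatorname{conv}(\Gamma)$, where $\Gamma$ runs through all $(N-k+1)$-point subsets (counting multiplicities) of $\operatorname{spec}(T)$. - $\Sigma_k(T)$ is the set of all $\lambda\in\operatorname{conv}(\operatorname{spec}(T))$ for which there are reals $t_j\ge 0$ with $\sum_{j=1}^N t_j=1$ and $\lambda=\sum_{j=1}^N t_j\lambda_j$, and complex numbers $\alpha_{ij}$ ($1\le i\le k$, $1\le j\le N$) with $|\alpha_{ij}|=\sqrt{t_j}$ for all $i,j$, such that $\sum_j\alpha_{ij}\overline{\alpha_{i'j}}=0$ and $\sum_j\lambda_j\alpha_{ij}\overline{\alpha_{i'j}}=0$ whenever $i\ne i'$. - $\mathrm{Conj}(N,k)$ is the statement that $\Lambda_k(U)=\Omega_k(U)$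 for every unitary operator $U$ with $N$ distinct eigenvalues on an $N$-dimensional complex Hilbert space. **Theorem.** Let $U$ be a unitary operator on a $5$-dimensional complex Hilbert space with five distinct eigenvalues. Then $\Omega_2(U)=\Sigma_2(U)$ and $\Lambda_2(U)=\Omega_2(U)$. In particular, $\mathrm{Conj}(5,2)$ holds. -/

import Mathlib

universe u

namespace HigherRank

noncomputable section

/-- The eigenvalues of an operator on a finite-dimensional complex space, listed with their
multiplicities. For normal operators the algebraic multiplicity used here is also the geometric
one. -/
def spec {H : Type*} [NormedAddCommGroup H] [InnerProductSpace ℂ H] [FiniteDimensional ℂ H]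
    (T : H →ₗ[ℂ] H) : Multiset ℂ :=
  T.charpoly.roots

/-- The rank-`k` numerical range `Λ_k(T)`: all `z` such that `P T P = z P` for some orthogonal
projection `P` of rank `k`. -/
def Lambda {H : Type*} [NormedAddCommGroup H] [InnerProductSpace ℂ H] [FiniteDimensional ℂ H]
    (k : ℕ) (T : H →ₗ[ℂ] H) : Set ℂ :=
  {z | ∃ P : H →ₗ[ℂ] H, IsStarProjection P ∧ Module.finrank ℂ (LinearMap.range P) = k ∧
    P * T * P = z • P}

/-- The set `Ω_k(T)`: the intersection of the convex hulls of all `(N - k + 1)`-point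
sub-multisets of the eigenvalues of `T` (counted with multiplicity), where `N = dim H`. -/
def Omega {H : Type*} [NormedAddCommGroup H] [InnerProductSpace ℂ H] [FiniteDimensional ℂ H]
    (k : ℕ) (T : H →ₗ[ℂ] H) : Set ℂ :=
  {z | ∀ G : Multiset ℂ, G ≤ spec T → Multiset.card G = Module.finrank ℂ H + 1 - k →
    z ∈ convexHull ℝ {w : ℂ | w ∈ G}}

/-- The set `Σ_k(T)`. Here `lam` enumerates the eigenvalues of `T` with multiplicity; reindexing
`t` and `a` along a permutation shows that the choice of the enumeration is immaterial. A point
`z` of the convex hull of the spectrum belongs to `Σ_k(T)` if, for one single convex combination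
`z = ∑ t_j lam_j`, there are complex `a_ij` of modulus `√t_j` such that for `i ≠ i'` both
`∑ a_ij conj(a_i'j)` and `∑ lam_j a_ij conj(a_i'j)` vanish. -/
def SigmaSet {H : Type*} [NormedAddCommGroup H] [InnerProductSpace ℂ H] [FiniteDimensional ℂ H]
    (k : ℕ) (T : H →ₗ[ℂ] H) : Set ℂ :=
  {z | z ∈ convexHull ℝ {w : ℂ | w ∈ spec T} ∧
    ∃ lam : Fin (Module.finrank ℂ H) → ℂ, Finset.univ.val.map lam = spec T ∧
    ∃ t : Fin (Module.finrank ℂ H) → ℝ,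
      (∀ j, 0 ≤ t j) ∧ ∑ j, t j = 1 ∧ z = ∑ j, (t j : ℂ) * lam j ∧
    ∃ a : Fin k → Fin (Module.finrank ℂ H) → ℂ,
      (∀ i j, ‖a i j‖ = Real.sqrt (t j)) ∧
      ∀ i i', i ≠ i' →
        ∑ j, a i j * starRingEnd ℂ (a i' j) = 0 ∧
        ∑ j, lam j * a i j * starRingEnd ℂ (a i' j) = 0}

/-- `Conj(N, k)`: the equality `Λ_k(U) = Ω_k(U)` for every unitary operator `U` with non-degenerate
spectrum on an `N`-dimensional Hilbert space. -/
def Conj (N k : ℕ) : Prop :=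
  ∀ (H : Type u) [NormedAddCommGroup H] [InnerProductSpace ℂ H] [FiniteDimensional ℂ H],
    Module.finrank ℂ H = N →
    ∀ U : H →ₗ[ℂ] H, U ∈ unitary (H →ₗ[ℂ] H) → (spec U).Nodup → Lambda k U = Omega k U

end

end HigherRank

/-! The cycle Ω₂ ⊆ Σ₂ ⊆ Λ₂ ⊆ Ω₂ gives both equalities. The last two inclusions are linear algebra in
an eigenbasis; all the work is in the first.

For two rows one may take `√t_j` and `η_j / √t_j` with `|η_j| = t_j`. Then `η` must be orthogonal to
1, `λ` and `conj λ`, and the weights `|η_j|` must have barycentre `z`. Lagrange interpolation at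
five nodes supplies `η_j = λ_j (c + d λ_j) / ∏ (λ_j - λ_i)`. On the unit circle `|c + d u|²`
realises every `a + ⟪u, b⟫` with `‖b‖ ≤ a`, `a > 0`, so `|η_j| = w_j √(a + ⟪λ_j, b⟫)` with `w_j` the
nodal weight (`exists_phases`). It remains to find `(a, b)` in the light cone for which the
barycentre is `z`.

This is a critical point equation: minimise the convex function `∑ w_j (a + ⟪λ_j, b⟫)^(3/2)` over
the compact slice `a + ⟪z, b⟫ = 1` of the cone. Either the minimiser solves the equation, or the
cone constraint is active with a positive multiplier at some `b = -a v`, `‖v‖ = 1`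
(`multiplier_of_le_on_coneSlice`). The second case is excluded by the line through the second and
fourth nodes, counted from `v` (`exists_separating_functional`): its affine functional annihilates
the weighted sum, is nonnegative at `z` because `z` lies in the hull of the nodes other than the
third, and is positive at `v`. -/

namespace HigherRank

open scoped InnerProductSpace

noncomputable section

/-! ### Lagrange nodal weights and the admissible phases -/

/-- The absolute value of the Lagrange nodal weight of the `j`-th node. -/
def nodeWeight {ι : Type*} [Fintype ι] [DecidableEq ι] (lam : ι → ℂ) (j : ι) : ℝ :=
  (∏ i ∈ Finset.univ.erase j, ‖lam j - lam i‖)⁻¹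

theorem nodeWeight_pos {ι : Type*} [Fintype ι] [DecidableEq ι] {lam : ι → ℂ}
    (hinj : Function.Injective lam) (j : ι) : 0 < nodeWeight lam j := by
  refine inv_pos.2 (Finset.prod_pos fun i hi => norm_pos_iff.2 (sub_ne_zero.2 fun h => ?_))
  exact (Finset.ne_of_mem_erase hi) (hinj h).symm

theorem nodeWeight_comp_perm {ι : Type*} [Fintype ι] [DecidableEq ι] (lam : ι → ℂ)
    (σ : Equiv.Perm ι) (j : ι) : nodeWeight (lam ∘ σ) j = nodeWeight lam (σ j) := by
  unfold nodeWeight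
  congr 1
  exact Finset.prod_equiv σ (by simp) (by simp)

/-- The sum is the coefficient of degree `card ι - 1` of the interpolant of `p`, which is `p`
itself. -/
theorem sum_eval_div_eq_zero {ι : Type*} [Fintype ι] [DecidableEq ι] {lam : ι → ℂ}
    (hinj : Function.Injective lam) {p : Polynomial ℂ}
    (hp : p.natDegree + 1 < Fintype.card ι) :
    ∑ j, p.eval (lam j) / ∏ i ∈ Finset.univ.erase j, (lam j - lam i) = 0 := by
  rw [← Lagrange.coeff_eq_sum (s := Finset.univ) hinj.injOn]
  · apply Polynomial.coeff_eq_zero_of_natDegree_lt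
    simp only [Finset.card_univ]; omega
  · refine lt_of_le_of_lt Polynomial.degree_le_natDegree ?_
    simp only [Finset.card_univ]
    exact_mod_cast (by omega : p.natDegree < Fintype.card ι)

/-- A nonnegative trigonometric polynomial of degree one is the squared modulus of an affine
polynomial on the unit circle. -/
theorem exists_normSq_affine {a : ℝ} {b : ℂ} (ha : 0 < a) (hb : ‖b‖ ≤ a) :
    ∃ c d : ℂ, ∀ u : ℂ, ‖u‖ = 1 → ‖c + d * u‖ ^ 2 = a + ⟪u, b⟫_ℝ := by
  set s := Real.sqrt (a ^ 2 - ‖b‖ ^ 2) with hs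
  have hs2 : s ^ 2 = a ^ 2 - ‖b‖ ^ 2 := Real.sq_sqrt (by nlinarith [norm_nonneg b])
  have hs0 : 0 ≤ s := Real.sqrt_nonneg _
  -- Comparing coefficients with real `c` and `d = conj b / (2c)` leaves `c⁴ - a c² + ‖b‖²/4 = 0`.
  -- The larger root for `c²` keeps `c` nonzero.
  set c := Real.sqrt ((a + s) / 2) with hc
  have hc2 : c ^ 2 = (a + s) / 2 := Real.sq_sqrt (by positivity)
  have hc0 : 0 < c := Real.sqrt_pos.2 (by positivity)
  have hbn : ‖b‖ ^ 2 = b.re ^ 2 + b.im ^ 2 := by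
    rw [Complex.sq_norm, Complex.normSq_apply]; ring
  refine ⟨c, starRingEnd ℂ b / ((2 * c : ℝ) : ℂ), fun u hu => ?_⟩
  have hu2 : u.re ^ 2 + u.im ^ 2 = 1 := by
    have : ‖u‖ ^ 2 = 1 := by rw [hu]; norm_num
    rw [Complex.sq_norm, Complex.normSq_apply] at this; linarith
  rw [Complex.sq_norm, Complex.normSq_apply, Complex.inner]
  rw [div_mul_eq_mul_div]
  simp only [Complex.add_re, Complex.add_im, Complex.ofReal_re, Complex.ofReal_im,
    Complex.div_ofReal_re, Complex.div_ofReal_im, Complex.mul_re, Complex.mul_im,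
    Complex.conj_re, Complex.conj_im]
  have key : c ^ 2 * c ^ 2 + (b.re ^ 2 + b.im ^ 2) / 4 = a * c ^ 2 := by
    rw [hc2, ← hbn]; linarith
  field_simp
  linear_combination 4 * key + (b.re ^ 2 + b.im ^ 2) * hu2

theorem exists_phases {lam : Fin 5 → ℂ} (hinj : Function.Injective lam)
    (hlam : ∀ j, ‖lam j‖ = 1) {a : ℝ} {b : ℂ} (ha : 0 < a) (hb : ‖b‖ ≤ a) :
    ∃ η : Fin 5 → ℂ, (∀ j, ‖η j‖ = nodeWeight lam j * Real.sqrt (a + ⟪lam j, b⟫_ℝ)) ∧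
      ∑ j, η j = 0 ∧ ∑ j, lam j * η j = 0 ∧ ∑ j, starRingEnd ℂ (lam j) * η j = 0 := by
  obtain ⟨c, d, hcd⟩ := exists_normSq_affine ha hb
  have hconj : ∀ j, starRingEnd ℂ (lam j) * lam j = 1 := fun j => by
    rw [Complex.conj_mul', hlam]; norm_num
  -- The extra factor `lam j` absorbs the conjugate, which is the inverse on the circle: the three
  -- sums involve polynomials of degree at most 2, 3 and 1, all below 4.
  refine ⟨fun j => lam j * (c + d * lam j) / ∏ i ∈ Finset.univ.erase j, (lam j - lam i),
    fun j => ?_, ?_, ?_, ?_⟩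
  · rw [norm_div, norm_mul, hlam, one_mul, norm_prod, ← hcd _ (hlam j),
      Real.sqrt_sq (norm_nonneg _), nodeWeight]
    ring
  · rw [← sum_eval_div_eq_zero hinj
      (p := Polynomial.X * (Polynomial.C c + Polynomial.C d * Polynomial.X))]
    · simp
    · have : (Polynomial.X * (Polynomial.C c + Polynomial.C d * Polynomial.X)).natDegree ≤ 2 := by
        compute_degree
      simp only [Fintype.card_fin]; omega
  · rw [← sum_eval_div_eq_zero hinj
      (p := Polynomial.X * (Polynomial.X * (Polynomial.C c + Polynomial.C d * Polynomial.X)))]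
    · simp [mul_div_assoc]
    · have : (Polynomial.X * (Polynomial.X *
          (Polynomial.C c + Polynomial.C d * Polynomial.X))).natDegree ≤ 3 := by
        compute_degree
      simp only [Fintype.card_fin]; omega
  · rw [← sum_eval_div_eq_zero hinj
      (p := Polynomial.C c + Polynomial.C d * Polynomial.X)]
    · refine Finset.sum_congr rfl fun j _ => ?_
      rw [← mul_div_assoc, ← mul_assoc, hconj]; simp
    · have : (Polynomial.C c + Polynomial.C d * Polynomial.X).natDegree ≤ 1 := by
        compute_degree
      simp only [Fintype.card_fin]; omega

/-! ### Convex minimisation on a slice of the light cone -/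

/-- First-order optimality for `∑ w_j (ℓ_j B)^{3/2}` on a convex set. -/
theorem sum_sqrt_mul_le_of_isMinOn {ι E : Type*} [Fintype ι] [NormedAddCommGroup E]
    [NormedSpace ℝ E] {K : Set E} (hK : Convex ℝ K) (w : ι → ℝ) (ℓ : ι → E →L[ℝ] ℝ) {B C : E}
    (hB : B ∈ K) (hC : C ∈ K)
    (hmin : IsMinOn (fun x => ∑ j, w j * (ℓ j x) ^ (3 / 2 : ℝ)) K B) :
    ∑ j, w j * Real.sqrt (ℓ j B) * ℓ j B ≤ ∑ j, w j * Real.sqrt (ℓ j B) * ℓ j C := by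
  have hd : HasFDerivAt (fun x => ∑ j, w j * (ℓ j x) ^ (3 / 2 : ℝ))
      (∑ j, w j • ((3 / 2 * (ℓ j B) ^ ((3 / 2 : ℝ) - 1)) • ℓ j)) B := by
    refine HasFDerivAt.fun_sum fun j _ => HasFDerivAt.const_mul ?_ _
    -- An exponent at least 1 makes the power differentiable even where `ℓ j B = 0`, as can happen
    -- on the boundary of the cone.
    exact (ℓ j).hasFDerivAt.rpow_const (Or.inr (by norm_num))
  have h : 0 ≤ (∑ j, w j • ((3 / 2 * (ℓ j B) ^ ((3 / 2 : ℝ) - 1)) • ℓ j)) (C - B) :=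
    hmin.localize.hasFDerivWithinAt_nonneg hd.hasFDerivWithinAt
    (sub_mem_posTangentConeAt_of_segment_subset (hK.segment_subset hB hC))
  have h2 : (3 / 2 : ℝ) - 1 = 1 / 2 := by norm_num
  simp only [h2, ← Real.sqrt_eq_rpow] at h
  simp only [sum_apply, smul_apply, map_sub (ℓ _), smul_eq_mul] at h
  have h3 : ∑ j, w j * (3 / 2 * √(ℓ j B) * (ℓ j C - ℓ j B)) =
      3 / 2 * (∑ j, w j * √(ℓ j B) * ℓ j C - ∑ j, w j * √(ℓ j B) * ℓ j B) := by
    rw [← Finset.sum_sub_distrib, Finset.mul_sum]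
    exact Finset.sum_congr rfl fun j _ => by ring
  rw [h3] at h
  linarith

/-- The slice of the closed light cone in `ℝ × ℂ` cut out by `a + ⟪z, b⟫ = 1`. -/
def coneSlice (z : ℂ) : Set (ℝ × ℂ) := {B | ‖B.2‖ ≤ B.1 ∧ B.1 + ⟪z, B.2⟫_ℝ = 1}

theorem convex_coneSlice (z : ℂ) : Convex ℝ (coneSlice z) := by
  rintro ⟨a, b⟩ ⟨h1, h2⟩ ⟨a', b'⟩ ⟨h1', h2'⟩ s t hs ht hst
  refine ⟨?_, ?_⟩
  · simp only [Prod.smul_mk, Prod.mk_add_mk, smul_eq_mul] at *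
    refine (norm_add_le _ _).trans ?_
    rw [norm_smul, norm_smul, Real.norm_of_nonneg hs, Real.norm_of_nonneg ht]
    gcongr
  · simp only [Prod.smul_mk, Prod.mk_add_mk, smul_eq_mul, inner_add_right, inner_smul_right] at *
    linear_combination s * h2 + t * h2' + hst

/-- This bounds the slice when `‖z‖ < 1`. -/
theorem one_sub_mul_le_of_mem_coneSlice {z : ℂ} {B : ℝ × ℂ} (hB : B ∈ coneSlice z) :
    (1 - ‖z‖) * B.1 ≤ 1 := by
  have h1 := neg_le_of_abs_le (abs_real_inner_le_norm z B.2)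
  have h2 := mul_le_mul_of_nonneg_left hB.1 (norm_nonneg z)
  have h3 := hB.2
  nlinarith

theorem isCompact_coneSlice {z : ℂ} (hz : ‖z‖ < 1) : IsCompact (coneSlice z) := by
  refine Metric.isCompact_of_isClosed_isBounded ?_ ?_
  · have h1 : IsClosed {B : ℝ × ℂ | ‖B.2‖ ≤ B.1} := isClosed_le (by fun_prop) (by fun_prop)
    have h2 : IsClosed {B : ℝ × ℂ | B.1 + ⟪z, B.2⟫_ℝ = 1} :=
      isClosed_eq (by fun_prop) (by fun_prop)
    exact h1.inter h2
  · refine (Metric.isBounded_closedBall (x := (0 : ℝ × ℂ)) (r := (1 - ‖z‖)⁻¹)).subset ?_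
    intro B hB
    have h0 : 0 < 1 - ‖z‖ := by linarith
    have h1 : B.1 ≤ (1 - ‖z‖)⁻¹ := by
      rw [← one_div, le_div_iff₀' h0]; exact one_sub_mul_le_of_mem_coneSlice hB
    have h2 : 0 ≤ B.1 := (norm_nonneg _).trans hB.1
    rw [mem_closedBall_zero_iff, Prod.norm_def, max_le_iff]
    exact ⟨by rwa [Real.norm_of_nonneg h2], hB.1.trans h1⟩

theorem fst_pos_of_mem_coneSlice {z : ℂ} {B : ℝ × ℂ} (hB : B ∈ coneSlice z) : 0 < B.1 := by
  refine lt_of_le_of_ne ((norm_nonneg _).trans hB.1) fun h => ?_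
  have h1 : B.2 = 0 := by
    have := hB.1; rw [← h] at this; exact norm_le_zero_iff.1 this
  have := hB.2
  rw [← h, h1] at this; simp at this

/-- Lagrange multipliers for a linear functional on `coneSlice z`. -/
theorem multiplier_of_le_on_coneSlice {z q : ℂ} {m : ℝ} (hz : ‖z‖ < 1) {B : ℝ × ℂ}
    (hB : B ∈ coneSlice z)
    (h : ∀ C ∈ coneSlice z, m * B.1 + ⟪q, B.2⟫_ℝ ≤ m * C.1 + ⟪q, C.2⟫_ℝ) :
    (m = m * B.1 + ⟪q, B.2⟫_ℝ ∧ q = m * z) ∨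
    ∃ ν : ℝ, 0 < ν ∧ ∃ v : ℂ, ‖v‖ = 1 ∧ B.2 = -(B.1 * v) ∧
      m = m * B.1 + ⟪q, B.2⟫_ℝ + ν ∧ q = ((m * B.1 + ⟪q, B.2⟫_ℝ : ℝ) : ℂ) * z + ν * v := by
  obtain ⟨a, b⟩ := B
  have ha : 0 < a := fst_pos_of_mem_coneSlice hB
  obtain ⟨hb, hab⟩ := hB
  simp only at *
  set μ := m * a + ⟪q, b⟫_ℝ with hμ
  set d : ℂ := q - μ • z with hd
  have hin : ∀ c, ⟪d, c⟫_ℝ = ⟪q, c⟫_ℝ - μ * ⟪z, c⟫_ℝ := fun c => by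
    rw [hd, inner_sub_left, real_inner_smul_left]
  have hdir : ∀ c : ℂ, ‖c‖ = 1 → 0 ≤ (m - μ) + ⟪d, c⟫_ℝ := fun c hc => by
    have hp : 0 < 1 + ⟪z, c⟫_ℝ := by
      have := neg_le_of_abs_le (abs_real_inner_le_norm z c)
      rw [hc, mul_one] at this; linarith
    -- The test points are the extreme rays `(1, c)` of the cone, rescaled into the slice.
    have h1 := h ((1 + ⟪z, c⟫_ℝ)⁻¹, (1 + ⟪z, c⟫_ℝ)⁻¹ • c) ⟨by
      simp only [norm_smul, hc, mul_one]
      rw [Real.norm_of_nonneg (inv_pos.2 hp).le], by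
      simp only [real_inner_smul_right]; field_simp⟩
    simp only [real_inner_smul_right] at h1
    have h2 : μ * (1 + ⟪z, c⟫_ℝ) ≤ m + ⟪q, c⟫_ℝ := by
      have := mul_le_mul_of_nonneg_right h1 hp.le
      field_simp at this
      linarith
    rw [hin]; linarith
  -- Complementary slackness: `(m - μ, d)` is nonnegative on the cone and vanishes at the minimiser.
  have hcomp : (m - μ) * a + ⟪d, b⟫_ℝ = 0 := by
    rw [hin]; linear_combination (-μ) * hab - hμ
  by_cases hd0 : d = 0
  · left
    rw [hd0, inner_zero_left, add_zero] at hcomp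
    have hm : m = μ := by
      rcases mul_eq_zero.1 hcomp with h' | h'
      · linarith
      · exact absurd h' ha.ne'
    refine ⟨hm, ?_⟩
    rw [← Complex.real_smul, hm, ← sub_eq_zero, ← hd, hd0]
  · right
    have hdn : 0 < ‖d‖ := norm_pos_iff.2 hd0
    have h1 : ‖d‖ ≤ m - μ := by
      have := hdir (-(‖d‖⁻¹ • d)) (by rw [norm_neg, norm_smul, norm_inv, norm_norm]; field_simp)
      rw [inner_neg_right, real_inner_smul_right, real_inner_self_eq_norm_sq] at this
      field_simp at this
      linarith
    have h2 : m - μ ≤ ‖d‖ := by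
      have h3 := neg_le_of_abs_le (abs_real_inner_le_norm d b)
      have h4 := mul_le_mul_of_nonneg_left hb hdn.le
      exact le_of_mul_le_mul_right (by linarith : (m - μ) * a ≤ ‖d‖ * a) ha
    have h5 : m - μ = ‖d‖ := le_antisymm h2 h1
    rw [h5] at hcomp
    have hv : ‖‖d‖⁻¹ • d‖ = 1 := by rw [norm_smul, norm_inv, norm_norm]; field_simp
    refine ⟨‖d‖, hdn, ‖d‖⁻¹ • d, hv, ?_, by linarith, ?_⟩
    -- Equality in Cauchy–Schwarz, together with `‖b‖ ≤ a`, forces `b = -a d / ‖d‖`.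
    · have h6 : ‖b + a • (‖d‖⁻¹ • d)‖ ^ 2 ≤ 0 := by
        rw [norm_add_sq_real, norm_smul a, hv, real_inner_smul_right, real_inner_smul_right,
          real_inner_comm, mul_one, Real.norm_of_nonneg ha.le]
        have h7 : ⟪d, b⟫_ℝ = -(‖d‖ * a) := by linarith
        rw [h7]
        have : ‖d‖⁻¹ * -(‖d‖ * a) = -a := by field_simp
        rw [this]
        nlinarith [norm_nonneg b]
      have h8 : b + a • (‖d‖⁻¹ • d) = 0 := by
        rw [← norm_eq_zero]; exact pow_eq_zero_iff two_ne_zero |>.1 (le_antisymm h6 (sq_nonneg _))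
      rw [← Complex.real_smul (x := a)]
      exact eq_neg_of_add_eq_zero_left h8
    · rw [← Complex.real_smul, ← Complex.real_smul, smul_inv_smul₀ hdn.ne', hd]; abel

/-! ### Half-angle trigonometry and the separating line -/

theorem inner_mul_exp_mul_exp {v : ℂ} (hv : ‖v‖ = 1) (s t : ℝ) :
    ⟪v * Complex.exp (s * Complex.I), v * Complex.exp (t * Complex.I)⟫_ℝ = Real.cos (t - s) := by
  have hv2 : v.re * v.re + v.im * v.im = 1 := by
    have : ‖v‖ ^ 2 = 1 := by rw [hv]; norm_num
    rwa [Complex.sq_norm, Complex.normSq_apply] at this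
  rw [Complex.inner, Real.cos_sub]
  simp only [Complex.mul_re, Complex.mul_im, map_mul, Complex.conj_re, Complex.conj_im,
    Complex.exp_ofReal_mul_I_re, Complex.exp_ofReal_mul_I_im]
  linear_combination (Real.cos t * Real.cos s + Real.sin t * Real.sin s) * hv2

theorem norm_mul_exp_sub_mul_exp {v : ℂ} (hv : ‖v‖ = 1) (s t : ℝ) :
    ‖v * Complex.exp ((2 * s : ℝ) * Complex.I) - v * Complex.exp ((2 * t : ℝ) * Complex.I)‖ =
      2 * |Real.sin (s - t)| := by
  have hn : ∀ x : ℝ, ‖v * Complex.exp (x * Complex.I)‖ = 1 := fun x => by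
    rw [norm_mul, hv, Complex.norm_exp_ofReal_mul_I, one_mul]
  refine (sq_eq_sq₀ (norm_nonneg _) (by positivity)).1 ?_
  rw [norm_sub_sq_real, hn, hn, inner_mul_exp_mul_exp hv, mul_pow, sq_abs,
    show 2 * t - 2 * s = 2 * (t - s) by ring, Real.cos_two_mul, Real.cos_sq',
    ← neg_sub s t, Real.sin_neg]
  ring

/-- Five points on the circle in order, seen from `v`: the affine functional vanishing at the
second and fourth one separates `z` and `v` from the third one and annihilates the weighted sum
of the five points. -/
theorem exists_separating_functional_of_strictMono {β : Fin 5 → ℝ} (hβ : StrictMono β)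
    (h0 : 0 ≤ β 0) (h4 : β 4 < Real.pi) {v z : ℂ} (hv : ‖v‖ = 1) {lam : Fin 5 → ℂ}
    (hlam : ∀ j, lam j = v * Complex.exp ((2 * β j : ℝ) * Complex.I))
    (hz : z ∈ convexHull ℝ (lam '' {j | j ≠ 2})) :
    ∃ (κ : ℝ) (n : ℂ), 0 ≤ κ + ⟪n, z⟫_ℝ ∧ 0 < κ + ⟪n, v⟫_ℝ ∧
      ∑ j, nodeWeight lam j * Real.sqrt (1 - ⟪lam j, v⟫_ℝ) * (κ + ⟪n, lam j⟫_ℝ) = 0 := by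
  have h01 : β 0 < β 1 := hβ (by decide)
  have h12 : β 1 < β 2 := hβ (by decide)
  have h23 : β 2 < β 3 := hβ (by decide)
  have h34 : β 3 < β 4 := hβ (by decide)
  have hs : ∀ x y : ℝ, x < y → 0 ≤ x → y < Real.pi → 0 < Real.sin (y - x) := fun x y h h' h'' =>
    Real.sin_pos_of_pos_of_lt_pi (by linarith) (by linarith)
  have hv' : v = v * Complex.exp ((2 * 0 : ℝ) * Complex.I) := by simp
  -- The normal of the chord joining nodes 1 and 3 points along the mean of their arguments;
  -- product-to-sum then factors the functional as in `hℓ`.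
  set n : ℂ := -(v * Complex.exp ((β 1 + β 3 : ℝ) * Complex.I)) with hn
  have hℓ : ∀ x : ℝ, Real.cos (β 3 - β 1) +
      ⟪n, v * Complex.exp ((2 * x : ℝ) * Complex.I)⟫_ℝ =
        2 * (Real.sin (β 1 - x) * Real.sin (β 3 - x)) := fun x => by
    rw [hn, inner_neg_left, inner_mul_exp_mul_exp hv,
      show β 3 - β 1 = (β 3 - x) - (β 1 - x) by ring, Real.cos_sub,
      show 2 * x - (β 1 + β 3) = -((β 3 - x) + (β 1 - x)) by ring, Real.cos_neg, Real.cos_add]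
    ring
  have hsq : ∀ j, Real.sqrt (1 - ⟪lam j, v⟫_ℝ) = Real.sqrt 2 * Real.sin (β j) := fun j => by
    have hj0 : β 0 ≤ β j := hβ.monotone (Fin.zero_le j)
    have hj4 : β j ≤ β 4 := hβ.monotone (Fin.le_last j)
    have : ⟪lam j, v⟫_ℝ = Real.cos (2 * β j) := by
      conv_lhs => rw [hv', hlam]
      rw [inner_mul_exp_mul_exp (by simpa using hv)]
      rw [← Real.cos_neg]; congr 1; ring
    rw [this, Real.cos_two_mul, Real.cos_sq',
      show 1 - (2 * (1 - Real.sin (β j) ^ 2) - 1) = 2 * Real.sin (β j) ^ 2 by ring,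
      Real.sqrt_mul (by norm_num), Real.sqrt_sq]
    exact Real.sin_nonneg_of_nonneg_of_le_pi (by linarith) (by linarith)
  have p01 := hs _ _ h01 h0 (by linarith)
  have p03 := hs (β 0) (β 3) (by linarith) h0 (by linarith)
  have p02 := hs (β 0) (β 2) (by linarith) h0 (by linarith)
  have p04 := hs (β 0) (β 4) (by linarith) h0 (by linarith)
  have p12 := hs (β 1) (β 2) h12 (by linarith) (by linarith)
  have p14 := hs (β 1) (β 4) (by linarith) (by linarith) (by linarith)
  have p23 := hs (β 2) (β 3) h23 (by linarith) (by linarith)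
  have p24 := hs (β 2) (β 4) (by linarith) (by linarith) (by linarith)
  have p34 := hs (β 3) (β 4) (by linarith) (by linarith) (by linarith)
  have hneg : ∀ x y : ℝ, Real.sin (x - y) = -Real.sin (y - x) := fun x y => by
    rw [← Real.sin_neg, neg_sub]
  refine ⟨Real.cos (β 3 - β 1), n, ?_, ?_, ?_⟩
  · have hc : Convex ℝ {x : ℂ | -Real.cos (β 3 - β 1) ≤ ⟪n, x⟫_ℝ} :=
      convex_halfSpace_ge (innerSL ℝ n).isLinear _
    have hsub : lam '' {j | j ≠ 2} ⊆ {x : ℂ | -Real.cos (β 3 - β 1) ≤ ⟪n, x⟫_ℝ} := by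
      rintro _ ⟨j, hj, rfl⟩
      have := hℓ (β j)
      rw [← hlam] at this
      have h' : 0 ≤ 2 * (Real.sin (β 1 - β j) * Real.sin (β 3 - β j)) := by
        fin_cases j
        · exact (mul_pos two_pos (mul_pos p01 p03)).le
        · simp
        · exact absurd rfl hj
        · simp
        · change 0 ≤ 2 * (Real.sin (β 1 - β 4) * Real.sin (β 3 - β 4))
          rw [hneg, hneg (β 3), neg_mul_neg]
          exact (mul_pos two_pos (mul_pos p14 p34)).le
      simp only [Set.mem_ofPred_eq]
      linarith
    have := convexHull_min hsub hc hz
    simp only [Set.mem_ofPred_eq] at this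
    linarith
  · have := hℓ 0
    rw [← hv'] at this
    rw [this, sub_zero, sub_zero]
    exact mul_pos two_pos (mul_pos
      (Real.sin_pos_of_pos_of_lt_pi (by linarith) (by linarith))
      (Real.sin_pos_of_pos_of_lt_pi (by linarith) (by linarith)))
  · have hw : ∀ j, nodeWeight lam j =
        (∏ i ∈ Finset.univ.erase j, 2 * |Real.sin (β j - β i)|)⁻¹ := fun j => by
      unfold nodeWeight
      simp only [hlam, norm_mul_exp_sub_mul_exp hv]
    have hℓ' : ∀ j, Real.cos (β 3 - β 1) + ⟪n, lam j⟫_ℝ =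
        2 * (Real.sin (β 1 - β j) * Real.sin (β 3 - β j)) := fun j => by
      rw [hlam]; exact hℓ _
    have e0 : (Finset.univ.erase 0 : Finset (Fin 5)) = {1, 2, 3, 4} := by decide
    have e2 : (Finset.univ.erase 2 : Finset (Fin 5)) = {0, 1, 3, 4} := by decide
    have e4 : (Finset.univ.erase 4 : Finset (Fin 5)) = {0, 1, 2, 3} := by decide
    have ha : ∀ x y : ℝ, 0 < Real.sin (y - x) → |Real.sin (y - x)| = Real.sin (y - x) :=
      fun x y h => abs_of_pos h
    have ha' : ∀ x y : ℝ, 0 < Real.sin (y - x) → |Real.sin (x - y)| = Real.sin (y - x) :=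
      fun x y h => by rw [hneg, abs_neg, abs_of_pos h]
    have w0 : nodeWeight lam 0 = (16 * (Real.sin (β 1 - β 0) * Real.sin (β 2 - β 0) *
        Real.sin (β 3 - β 0) * Real.sin (β 4 - β 0)))⁻¹ := by
      rw [hw, e0, Finset.prod_insert (by decide), Finset.prod_insert (by decide),
        Finset.prod_insert (by decide), Finset.prod_singleton, ha' _ _ p01, ha' _ _ p02,
        ha' _ _ p03, ha' _ _ p04]
      ring
    have w2 : nodeWeight lam 2 = (16 * (Real.sin (β 2 - β 0) * Real.sin (β 2 - β 1) *
        Real.sin (β 3 - β 2) * Real.sin (β 4 - β 2)))⁻¹ := by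
      rw [hw, e2, Finset.prod_insert (by decide), Finset.prod_insert (by decide),
        Finset.prod_insert (by decide), Finset.prod_singleton, ha _ _ p02, ha _ _ p12,
        ha' _ _ p23, ha' _ _ p24]
      ring
    have w4 : nodeWeight lam 4 = (16 * (Real.sin (β 4 - β 0) * Real.sin (β 4 - β 1) *
        Real.sin (β 4 - β 2) * Real.sin (β 4 - β 3)))⁻¹ := by
      rw [hw, e4, Finset.prod_insert (by decide), Finset.prod_insert (by decide),
        Finset.prod_insert (by decide), Finset.prod_singleton, ha _ _ p04, ha _ _ p14,
        ha _ _ p24, ha _ _ p34]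
      ring
    -- Nodes 1 and 3 drop out. In the other three terms the functional cancels, up to sign, the
    -- weight factors involving nodes 1 and 3, leaving this three-term sine identity.
    have key : Real.sin (β 0) * Real.sin (β 4 - β 2) - Real.sin (β 2) * Real.sin (β 4 - β 0) +
        Real.sin (β 4) * Real.sin (β 2 - β 0) = 0 := by
      rw [Real.sin_sub, Real.sin_sub, Real.sin_sub]; ring
    rw [Fin.sum_univ_five, hℓ', hℓ', hℓ', hℓ', hℓ', hsq, hsq, hsq, hsq, hsq, w0, w2, w4,
      sub_self, sub_self, Real.sin_zero, hneg (β 1) (β 2), hneg (β 1) (β 4), hneg (β 3) (β 4)]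
    simp only [zero_mul, mul_zero, add_zero]
    field_simp
    linear_combination 2 * Real.sqrt 2 * key

theorem exists_eq_mul_exp {v u : ℂ} (hv : ‖v‖ = 1) (hu : ‖u‖ = 1) :
    ∃ β : ℝ, 0 ≤ β ∧ β < Real.pi ∧ u = v * Complex.exp ((2 * β : ℝ) * Complex.I) := by
  have hpi := Real.two_pi_pos
  have hv0 : v ≠ 0 := norm_ne_zero_iff.1 (by rw [hv]; exact one_ne_zero)
  have h := toIcoMod_mem_Ico hpi 0 (Complex.arg (u / v))
  refine ⟨toIcoMod hpi 0 (Complex.arg (u / v)) / 2, by linarith [h.1], by linarith [h.2], ?_⟩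
  have h1 : Complex.exp ((Complex.arg (u / v) : ℝ) * Complex.I) = u / v := by
    have := Complex.norm_mul_exp_arg_mul_I (u / v)
    rwa [norm_div, hu, hv, div_one, Complex.ofReal_one, one_mul] at this
  rw [mul_div_cancel₀ _ (two_ne_zero' ℝ)]
  have h2 := toIcoMod_add_toIcoDiv_zsmul hpi 0 (Complex.arg (u / v))
  have h3 : Complex.exp ((toIcoMod hpi 0 (Complex.arg (u / v)) : ℝ) * Complex.I) = u / v := by
    refine Eq.trans ?_ h1
    rw [Complex.exp_eq_exp_iff_exists_int]
    refine ⟨-toIcoDiv hpi 0 (Complex.arg (u / v)), ?_⟩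
    have h3 := congrArg (fun x : ℝ => (x : ℂ)) h2
    push_cast [zsmul_eq_mul] at h3 ⊢
    linear_combination Complex.I * h3
  rw [h3]; field_simp

/-- Sorting the half-angles reduces to the ordered case. Which node is third depends on `v`, hence
the hypothesis for every `i`. -/
theorem exists_separating_functional {v z : ℂ} (hv : ‖v‖ = 1) {lam : Fin 5 → ℂ}
    (hinj : Function.Injective lam) (hlam : ∀ j, ‖lam j‖ = 1)
    (hz : ∀ i, z ∈ convexHull ℝ (lam '' {j | j ≠ i})) :
    ∃ (κ : ℝ) (n : ℂ), 0 ≤ κ + ⟪n, z⟫_ℝ ∧ 0 < κ + ⟪n, v⟫_ℝ ∧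
      ∑ j, nodeWeight lam j * Real.sqrt (1 - ⟪lam j, v⟫_ℝ) * (κ + ⟪n, lam j⟫_ℝ) = 0 := by
  choose β h0 hpi hβ using fun j => exists_eq_mul_exp hv (hlam j)
  have hβinj : Function.Injective β := fun i j h => hinj (by rw [hβ, hβ j, h])
  set σ := Tuple.sort β
  have hmono : StrictMono (β ∘ σ) :=
    (Tuple.monotone_sort β).strictMono_of_injective (hβinj.comp σ.injective)
  have himg : lam '' {j | j ≠ σ 2} ⊆ (lam ∘ σ) '' {j | j ≠ 2} := by
    rintro _ ⟨j, hj, rfl⟩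
    refine ⟨σ.symm j, fun h => hj ?_, by simp⟩
    rw [← h, Equiv.apply_symm_apply]
  obtain ⟨κ, n, h1, h2, h3⟩ := exists_separating_functional_of_strictMono hmono (h0 _) (hpi _) hv
    (lam := lam ∘ σ) (fun j => hβ (σ j)) (convexHull_mono himg (hz (σ 2)))
  refine ⟨κ, n, h1, h2, ?_⟩
  rw [← h3, ← Equiv.sum_comp σ]
  simp only [nodeWeight_comp_perm, Function.comp_apply]

/-! ### Convex hulls of points on the circle -/

theorem exists_weights_of_mem_convexHull_image {ι : Type*} [Fintype ι] {lam : ι → ℂ} {s : Set ι}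
    {z : ℂ} (hz : z ∈ convexHull ℝ (lam '' s)) :
    ∃ t : ι → ℝ, (∀ j, 0 ≤ t j) ∧ (∀ j ∉ s, t j = 0) ∧ ∑ j, t j = 1 ∧
      ∑ j, (t j : ℂ) * lam j = z := by
  classical
  have hc : Convex ℝ {x : ℂ | ∃ t : ι → ℝ, (∀ j, 0 ≤ t j) ∧ (∀ j ∉ s, t j = 0) ∧
      ∑ j, t j = 1 ∧ ∑ j, (t j : ℂ) * lam j = x} := by
    rintro _ ⟨t, h1, h2, h3, rfl⟩ _ ⟨t', h1', h2', h3', rfl⟩ p q hp hq hpq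
    refine ⟨fun j => p * t j + q * t' j, fun j => ?_, fun j hj => ?_, ?_, ?_⟩
    · have := h1 j; have := h1' j; positivity
    · simp [h2 j hj, h2' j hj]
    · rw [Finset.sum_add_distrib, ← Finset.mul_sum, ← Finset.mul_sum, h3, h3']; linarith
    · simp only [Complex.real_smul, Finset.mul_sum, ← Finset.sum_add_distrib]
      exact Finset.sum_congr rfl fun j _ => by push_cast; ring
  refine convexHull_min ?_ hc hz
  rintro _ ⟨i, hi, rfl⟩
  refine ⟨Pi.single i 1, fun j => ?_, fun j hj => ?_, by simp, ?_⟩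
  · by_cases h : j = i
    · subst h; simp
    · simp [h]
  · rw [Pi.single_eq_of_ne]; rintro rfl; exact hj hi
  · rw [Finset.sum_eq_single i] <;> simp +contextual

/-- By strict convexity of the disc, a unit `z` would equal some node other than any prescribed one,
contradicting injectivity. -/
theorem norm_lt_one_of_mem_convexHull {ι : Type*} [Fintype ι] [Nonempty ι] {lam : ι → ℂ}
    (hlam : ∀ j, ‖lam j‖ = 1) (hinj : Function.Injective lam) {z : ℂ}
    (hz : ∀ i, z ∈ convexHull ℝ (lam '' {j | j ≠ i})) : ‖z‖ < 1 := by
  have hle : ∀ i, ⟪z, lam i⟫_ℝ ≤ ‖z‖ := fun i => by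
    simpa [hlam] using real_inner_le_norm z (lam i)
  by_contra! hge
  have hz1 : ‖z‖ = 1 := le_antisymm (by
    have hsub : lam '' {j | j ≠ Classical.arbitrary ι} ⊆ Metric.closedBall 0 1 := by
      rintro _ ⟨j, _, rfl⟩; simp [hlam]
    simpa using convexHull_min hsub (convex_closedBall _ _) (hz (Classical.arbitrary ι))) hge
  have hex : ∀ i, ∃ j, j ≠ i ∧ lam j = z := fun i => by
    obtain ⟨t, h0, h1, h2, h3⟩ := exists_weights_of_mem_convexHull_image (hz i)
    have h4 : ∑ j, t j * ⟪z, lam j⟫_ℝ = 1 := by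
      have : ⟪z, ∑ j, (t j : ℂ) * lam j⟫_ℝ = ∑ j, t j * ⟪z, lam j⟫_ℝ := by
        simp only [← Complex.real_smul, inner_sum, real_inner_smul_right]
      rw [← this, h3, real_inner_self_eq_norm_sq, hz1, one_pow]
    have hs : ∑ j, t j * (1 - ⟪z, lam j⟫_ℝ) = 0 := by
      simp only [mul_sub, mul_one, Finset.sum_sub_distrib, h2, h4, sub_self]
    have hs' := (Finset.sum_eq_zero_iff_of_nonneg fun j _ =>
      mul_nonneg (h0 j) (by linarith [hle j])).1 hs
    obtain ⟨j, -, hj⟩ : ∃ j ∈ Finset.univ, t j ≠ 0 := by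
      apply Finset.exists_ne_zero_of_sum_ne_zero
      rw [h2]; exact one_ne_zero
    refine ⟨j, fun h => hj (h1 j (fun h' => h' h)), ?_⟩
    have h5 : ⟪z, lam j⟫_ℝ = 1 := by
      have := (mul_eq_zero.1 (hs' j (Finset.mem_univ j))).resolve_left hj
      linarith
    exact ((inner_eq_one_iff_of_norm_eq_one hz1 (hlam j)).1 h5).symm
  obtain ⟨j, -, hj⟩ := hex (Classical.arbitrary ι)
  obtain ⟨j', hne, hj'⟩ := hex j
  exact hne (hinj (hj'.trans hj.symm))

/-! ### The minimiser and the resulting pair of rows -/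

/-- The power 3/2 is chosen so that the gradient at `(a, b)` is 3/2 times `(∑ t_j, ∑ t_j λ_j)` with
`t_j = w_j √(a + ⟪λ_j, b⟫)`; proportionality to `(1, z)` is the claim. -/
theorem exists_minimizer_data {lam : Fin 5 → ℂ} (hinj : Function.Injective lam)
    (hlam : ∀ j, ‖lam j‖ = 1) {z : ℂ} (hz : ∀ i, z ∈ convexHull ℝ (lam '' {j | j ≠ i})) :
    ∃ (a : ℝ) (b : ℂ), 0 < a ∧ ‖b‖ ≤ a ∧
      ∑ j, (nodeWeight lam j * Real.sqrt (a + ⟪lam j, b⟫_ℝ) : ℝ) * lam j =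
        (∑ j, nodeWeight lam j * Real.sqrt (a + ⟪lam j, b⟫_ℝ) : ℝ) * z := by
  have hz1 := norm_lt_one_of_mem_convexHull hlam hinj hz
  set ℓ : Fin 5 → (ℝ × ℂ) →L[ℝ] ℝ := fun j => ContinuousLinearMap.fst ℝ ℝ ℂ +
    (innerSL ℝ (lam j)).comp (ContinuousLinearMap.snd ℝ ℝ ℂ) with hℓ
  have hℓa : ∀ j B, ℓ j B = B.1 + ⟪lam j, B.2⟫_ℝ := fun j B => by simp [hℓ]
  obtain ⟨B, hB, hmin⟩ := (isCompact_coneSlice hz1).exists_isMinOn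
    ⟨((1 : ℝ), (0 : ℂ)), by simp [coneSlice]⟩
    (f := fun x => ∑ j, nodeWeight lam j * (ℓ j x) ^ (3 / 2 : ℝ)) (by
      refine Continuous.continuousOn (continuous_finsetSum _ fun j _ => ?_)
      exact continuous_const.mul ((ℓ j).continuous.rpow_const fun x => Or.inr (by norm_num)))
  set t : Fin 5 → ℝ := fun j => nodeWeight lam j * Real.sqrt (ℓ j B) with ht
  have hsum : ∀ C : ℝ × ℂ, ∑ j, nodeWeight lam j * Real.sqrt (ℓ j B) * ℓ j C =
      (∑ j, t j) * C.1 + ⟪∑ j, (t j : ℂ) * lam j, C.2⟫_ℝ := fun C => by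
    simp only [← Complex.real_smul, sum_inner, real_inner_smul_left, Finset.sum_mul,
      ← Finset.sum_add_distrib, ht]
    exact Finset.sum_congr rfl fun j _ => by rw [hℓa j C]; ring
  have hfirst : ∀ C ∈ coneSlice z,
      (∑ j, t j) * B.1 + ⟪∑ j, (t j : ℂ) * lam j, B.2⟫_ℝ ≤
        (∑ j, t j) * C.1 + ⟪∑ j, (t j : ℂ) * lam j, C.2⟫_ℝ := fun C hC => by
    rw [← hsum, ← hsum]
    exact sum_sqrt_mul_le_of_isMinOn (convex_coneSlice z) _ ℓ hB hC hmin
  have ha := fst_pos_of_mem_coneSlice hB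
  rcases multiplier_of_le_on_coneSlice hz1 hB hfirst with ⟨-, h⟩ | ⟨ν, hν, v, hv, hb, hm, hq⟩
  · refine ⟨B.1, B.2, ha, hB.1, ?_⟩
    simpa only [ht, hℓa] using h
  · exfalso
    obtain ⟨κ, n, h1, h2, h3⟩ := exists_separating_functional (z := z) hv hinj hlam hz
    have hμ : 0 ≤ (∑ j, t j) * B.1 + ⟪∑ j, (t j : ℂ) * lam j, B.2⟫_ℝ := by
      rw [← hsum]
      refine Finset.sum_nonneg fun j _ => ?_
      have hpos : 0 ≤ ℓ j B := by
        rw [hℓa]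
        have := neg_le_of_abs_le (abs_real_inner_le_norm (lam j) B.2)
        rw [hlam, one_mul] at this
        linarith [hB.1]
      have := (nodeWeight_pos hinj j).le
      positivity
    set μ := (∑ j, t j) * B.1 + ⟪∑ j, (t j : ℂ) * lam j, B.2⟫_ℝ
    have hlt : ∀ j, t j = Real.sqrt B.1 * (nodeWeight lam j * Real.sqrt (1 - ⟪lam j, v⟫_ℝ)) :=
      fun j => by
        have : ℓ j B = B.1 * (1 - ⟪lam j, v⟫_ℝ) := by
          rw [hℓa, hb, inner_neg_right, ← Complex.real_smul, real_inner_smul_right]; ring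
        simp only [ht]
        rw [this, Real.sqrt_mul ha.le]; ring
    have hzero : κ * ∑ j, t j + ⟪n, ∑ j, (t j : ℂ) * lam j⟫_ℝ = 0 := by
      simp only [← Complex.real_smul, inner_sum, real_inner_smul_right, Finset.mul_sum,
        ← Finset.sum_add_distrib]
      rw [← mul_zero (Real.sqrt B.1), ← h3, Finset.mul_sum]
      exact Finset.sum_congr rfl fun j _ => by rw [hlt]; ring
    rw [hq, hm, ← Complex.real_smul, ← Complex.real_smul, inner_add_right,
      real_inner_smul_right, real_inner_smul_right] at hzero
    -- `hzero` now reads `μ (κ + ⟪n, z⟫) + ν (κ + ⟪n, v⟫) = 0`, a nonnegative plus a positive term.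
    nlinarith [mul_nonneg hμ h1, mul_pos hν h2]

theorem sum_nodeWeight_mul_sqrt_pos {lam : Fin 5 → ℂ} (hinj : Function.Injective lam)
    (hlam : ∀ j, ‖lam j‖ = 1) {a : ℝ} {b : ℂ} (ha : 0 < a) (hb : ‖b‖ ≤ a) :
    0 < ∑ j, nodeWeight lam j * Real.sqrt (a + ⟪lam j, b⟫_ℝ) := by
  have hw := nodeWeight_pos hinj
  refine Finset.sum_pos' (fun j _ => by have := (hw j).le; positivity) ?_
  by_contra! hcon
  have hz : ∀ j, a • lam j = -b := fun j => by
    have h1 := hcon j (Finset.mem_univ j)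
    have h2 : a + ⟪lam j, b⟫_ℝ ≤ 0 := by
      by_contra! h
      exact absurd (mul_pos (hw j) (Real.sqrt_pos.2 h)) (not_lt.2 h1)
    have h3 : ‖a • lam j + b‖ ^ 2 ≤ 0 := by
      rw [norm_add_sq_real, norm_smul, hlam, real_inner_smul_left, Real.norm_of_nonneg ha.le]
      nlinarith [norm_nonneg b]
    rw [← add_eq_zero_iff_eq_neg, ← norm_eq_zero]
    exact pow_eq_zero_iff two_ne_zero |>.1 (le_antisymm h3 (sq_nonneg _))
  have : lam 0 = lam 1 := smul_right_injective ℂ ha.ne' ((hz 0).trans (hz 1).symm)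
  exact absurd (hinj this) (by decide)

theorem exists_sigma_data {lam : Fin 5 → ℂ} (hinj : Function.Injective lam)
    (hlam : ∀ j, ‖lam j‖ = 1) {z : ℂ} (hz : ∀ i, z ∈ convexHull ℝ (lam '' {j | j ≠ i})) :
    ∃ t : Fin 5 → ℝ, (∀ j, 0 ≤ t j) ∧ ∑ j, t j = 1 ∧ z = ∑ j, (t j : ℂ) * lam j ∧
      ∃ a : Fin 2 → Fin 5 → ℂ, (∀ i j, ‖a i j‖ = Real.sqrt (t j)) ∧
        ∀ i i', i ≠ i' → ∑ j, a i j * starRingEnd ℂ (a i' j) = 0 ∧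
          ∑ j, lam j * a i j * starRingEnd ℂ (a i' j) = 0 := by
  obtain ⟨a, b, ha, hb, hz'⟩ := exists_minimizer_data hinj hlam hz
  obtain ⟨η, hη, e1, e2, e3⟩ := exists_phases hinj hlam ha hb
  have hm := sum_nodeWeight_mul_sqrt_pos hinj hlam ha hb
  simp only [← hη] at hz' hm
  set m := ∑ j, ‖η j‖ with hm'
  have hmc : (m : ℂ) ≠ 0 := Complex.ofReal_ne_zero.2 hm.ne'
  set s : Fin 5 → ℝ := fun j => Real.sqrt (‖η j‖ / m) with hs
  have hs2 : ∀ j, s j * s j = ‖η j‖ / m := fun j => Real.mul_self_sqrt (by positivity)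
  have hs0 : ∀ j, s j = 0 → η j = 0 := fun j h => by
    have := hs2 j
    rw [h, mul_zero, eq_comm, div_eq_zero_iff] at this
    exact norm_eq_zero.1 (this.resolve_right hm.ne')
  -- Where `s j = 0` the quotient is 0 by convention, which is harmless because `η j = 0` there.
  have hprod : ∀ j, (s j : ℂ) * (η j / (m * s j)) = η j / m := fun j => by
    by_cases h : s j = 0
    · simp [h, hs0 j h]
    · have : (s j : ℂ) ≠ 0 := Complex.ofReal_ne_zero.2 h
      field_simp
  have hs1 : ∀ j, starRingEnd ℂ (s j : ℂ) = s j := fun j => Complex.conj_ofReal _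
  have hm1 : starRingEnd ℂ (m : ℂ) = m := Complex.conj_ofReal _
  refine ⟨fun j => ‖η j‖ / m, fun j => by positivity, ?_, ?_,
    ![fun j => (s j : ℂ), fun j => η j / (m * s j)], ?_, ?_⟩
  · rw [← Finset.sum_div, ← hm', div_self hm.ne']
  · rw [eq_comm, ← mul_right_inj' hmc, ← hz', Finset.mul_sum]
    exact Finset.sum_congr rfl fun j _ => by push_cast; field_simp
  · intro i j
    have hsn : 0 ≤ s j := Real.sqrt_nonneg _
    fin_cases i
    · simp only [Fin.zero_eta, Matrix.cons_val_zero]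
      rw [Complex.norm_real, Real.norm_of_nonneg hsn]
    · simp only [Fin.mk_one, Matrix.cons_val_one, Matrix.cons_val_fin_one]
      rw [norm_div, norm_mul, Complex.norm_real, Complex.norm_real, Real.norm_of_nonneg hsn,
        Real.norm_of_nonneg hm.le, ← div_div]
      change ‖η j‖ / m / s j = s j
      rw [← hs2]
      exact mul_self_div_self _
  · have k1 : ∑ j, (s j : ℂ) * (η j / (m * s j)) = 0 := by
      simp only [hprod, ← Finset.sum_div, e1, zero_div]
    have k2 : ∑ j, lam j * ((s j : ℂ) * (η j / (m * s j))) = 0 := by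
      simp only [hprod, ← mul_div_assoc, ← Finset.sum_div, e2, zero_div]
    have k3 : ∑ j, starRingEnd ℂ (lam j) * ((s j : ℂ) * (η j / (m * s j))) = 0 := by
      simp only [hprod, ← mul_div_assoc, ← Finset.sum_div, e3, zero_div]
    have c1 := congrArg (starRingEnd ℂ) k1
    have c3 := congrArg (starRingEnd ℂ) k3
    simp only [map_sum, map_mul, map_div₀, hs1, hm1, map_zero, Complex.conj_conj] at c1 c3
    intro i i' hii
    fin_cases i <;> fin_cases i'
    · exact absurd rfl hii
    · refine ⟨?_, ?_⟩
      · simpa [hs1, hm1] using c1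
      · simpa [hs1, hm1, mul_assoc] using c3
    · refine ⟨?_, ?_⟩
      · simpa [hs1, mul_comm] using k1
      · rw [← k2]
        refine Finset.sum_congr rfl fun j _ => ?_
        simp [hs1]; ring
    · exact absurd rfl hii

/-! ### Eigenbases and the inclusions between the operator sets -/

variable {H : Type*} [NormedAddCommGroup H] [InnerProductSpace ℂ H] [FiniteDimensional ℂ H]

theorem exists_enumeration_spec (T : H →ₗ[ℂ] H) :
    ∃ lam : Fin (Module.finrank ℂ H) → ℂ, Finset.univ.val.map lam = spec T := by
  have hcard : (spec T).card = Module.finrank ℂ H := by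
    rw [spec, Polynomial.splits_iff_card_roots.1 (IsAlgClosed.splits _),
      LinearMap.charpoly_natDegree]
  obtain ⟨l, hl⟩ := Quot.exists_rep (spec T)
  have hl' : (l : Multiset ℂ) = spec T := hl
  rw [← hl', Multiset.coe_card] at hcard
  refine ⟨fun i => l.get (Fin.cast hcard.symm i), ?_⟩
  rw [Fin.univ_val_map, ← hl']
  congr 1
  refine List.ext_get (by simp [hcard]) fun n h1 h2 => by simp

theorem inner_map_map_of_mem_unitary {U : H →ₗ[ℂ] H} (hU : U ∈ unitary (H →ₗ[ℂ] H)) (x y : H) :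
    ⟪U x, U y⟫_ℂ = ⟪x, y⟫_ℂ := by
  have h : star U * U = 1 := (Unitary.mem_iff.1 hU).1
  rw [← LinearMap.adjoint_inner_right, ← LinearMap.star_eq_adjoint, ← Module.End.mul_apply, h,
    Module.End.one_apply]

theorem injective_of_nodup_spec {T : H →ₗ[ℂ] H} (hT : (spec T).Nodup)
    {lam : Fin (Module.finrank ℂ H) → ℂ} (hlam : Finset.univ.val.map lam = spec T) :
    Function.Injective lam := by
  rw [← hlam] at hT
  exact fun i j h => Multiset.inj_on_of_nodup_map hT i (Finset.mem_univ i) j (Finset.mem_univ j) h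

/-- A unitary operator with simple spectrum is diagonal in an orthonormal basis. -/
theorem exists_eigenbasis {U : H →ₗ[ℂ] H} (hU : U ∈ unitary (H →ₗ[ℂ] H)) (hs : (spec U).Nodup)
    {lam : Fin (Module.finrank ℂ H) → ℂ} (hlam : Finset.univ.val.map lam = spec U) :
    (∀ j, ‖lam j‖ = 1) ∧
      ∃ e : OrthonormalBasis (Fin (Module.finrank ℂ H)) ℂ H, ∀ j, U (e j) = lam j • e j := by
  have hinj := injective_of_nodup_spec hs hlam
  have hev : ∀ j, ∃ x : H, ‖x‖ = 1 ∧ U x = lam j • x := fun j => by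
    have hmem : lam j ∈ U.charpoly.roots := by
      change lam j ∈ spec U
      rw [← hlam]; exact Multiset.mem_map_of_mem _ (Finset.mem_univ j)
    have hroot := (Module.End.hasEigenvalue_iff_isRoot_charpoly U (lam j)).2
      (Polynomial.isRoot_of_mem_roots hmem)
    obtain ⟨x, hx⟩ := hroot.exists_hasEigenvector
    have hx0 : (‖x‖ : ℂ) ≠ 0 := Complex.ofReal_ne_zero.2 (norm_ne_zero_iff.2 hx.2)
    refine ⟨(‖x‖ : ℂ)⁻¹ • x, ?_, ?_⟩
    · rw [norm_smul, norm_inv, Complex.norm_real, norm_norm]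
      exact inv_mul_cancel₀ (norm_ne_zero_iff.2 hx.2)
    · rw [map_smul, hx.apply_eq_smul, smul_comm]
  choose v hv1 hv2 using hev
  have hl1 : ∀ j, ‖lam j‖ = 1 := fun j => by
    have h := inner_map_map_of_mem_unitary hU (v j) (v j)
    rw [inner_self_eq_norm_sq_to_K, inner_self_eq_norm_sq_to_K, hv2, norm_smul, hv1, mul_one] at h
    have h' : ‖lam j‖ ^ 2 = 1 := by
      have h2 : ((‖lam j‖ ^ 2 : ℝ) : ℂ) = (1 : ℝ) := by push_cast; simpa using h
      exact_mod_cast h2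
    exact (pow_eq_one_iff_of_nonneg (norm_nonneg _) two_ne_zero).1 h'
  have horth : Orthonormal ℂ v := by
    refine ⟨hv1, fun i j hij => ?_⟩
    have h := inner_map_map_of_mem_unitary hU (v i) (v j)
    rw [hv2, hv2, inner_smul_left, inner_smul_right, ← mul_assoc] at h
    by_contra hne
    have h1 : starRingEnd ℂ (lam i) * lam j = 1 := mul_right_cancel₀ hne (h.trans (one_mul _).symm)
    have h2 : starRingEnd ℂ (lam i) * lam i = 1 := by rw [Complex.conj_mul', hl1]; norm_num
    have h3 : starRingEnd ℂ (lam i) ≠ 0 := left_ne_zero_of_mul_eq_one h2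
    exact hij (hinj (mul_left_cancel₀ h3 (h2.trans h1.symm)))
  refine ⟨hl1, ?_⟩
  obtain ⟨b, hb⟩ := Orthonormal.exists_orthonormalBasis_extension_of_card_eq (v := v)
    (s := Set.univ) (by simp) (horth.comp _ Subtype.val_injective)
  exact ⟨b, fun j => by rw [hb j (Set.mem_univ j)]; exact hv2 j⟩

/-- An orthonormal `k`-tuple on which the compression of `T` is scalar gives a point of the
rank-`k` numerical range. -/
theorem mem_Lambda_of_orthonormal {k : ℕ} {T : H →ₗ[ℂ] H} {z : ℂ} {x : Fin k → H}
    (hx : Orthonormal ℂ x) (hT : ∀ i i', ⟪x i, T (x i')⟫_ℂ = z * ⟪x i, x i'⟫_ℂ) :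
    z ∈ Lambda k T := by
  set V : Submodule ℂ H := Submodule.span ℂ (Set.range x) with hV
  have hW : ∀ v ∈ V, T v - z • v ∈ Vᗮ := by
    have : V ≤ (Vᗮ).comap (T - z • LinearMap.id) := by
      rw [hV, Submodule.span_le]
      rintro _ ⟨i', rfl⟩
      simp only [Submodule.comap_coe, Set.mem_preimage, SetLike.mem_coe]
      rw [Submodule.mem_orthogonal]
      intro u hu
      induction hu using Submodule.span_induction with
      | mem u hu =>
        obtain ⟨i, rfl⟩ := hu
        simp [inner_sub_right, inner_smul_right, hT]
      | zero => simp
      | add u w _ _ hu hw => rw [inner_add_left, hu, hw, add_zero]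
      | smul c u _ hu => rw [inner_smul_left, hu, mul_zero]
    exact fun v hv => by simpa using this hv
  refine ⟨(V.starProjection : H →ₗ[ℂ] H), ?_, ?_, ?_⟩
  · exact LinearMap.isStarProjection_toContinuousLinearMap_iff.1 isStarProjection_starProjection
  · have : LinearMap.range (V.starProjection : H →ₗ[ℂ] H) = V := by
      exact Submodule.range_starProjection V
    rw [this, hV, finrank_span_eq_card hx.linearIndependent, Fintype.card_fin]
  · ext y
    have hmem : V.starProjection y ∈ V := Submodule.starProjection_apply_mem V y
    have h := hW _ hmem
    simp only [Module.End.mul_apply, LinearMap.smul_apply, ContinuousLinearMap.coe_coe]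
    refine Submodule.eq_starProjection_of_mem_orthogonal (V.smul_mem z hmem) h

/-- The rows of `a` are coordinates, in an eigenbasis, of orthonormal vectors on which the
compression of `U` is `z`. -/
theorem SigmaSet_subset_Lambda {U : H →ₗ[ℂ] H} (hU : U ∈ unitary (H →ₗ[ℂ] H))
    (hs : (spec U).Nodup) (k : ℕ) : SigmaSet k U ⊆ Lambda k U := by
  rintro z ⟨-, lam, hlam, t, ht0, ht1, hz, a, ha, horth⟩
  obtain ⟨-, e, he⟩ := exists_eigenbasis hU hs hlam
  have hin : ∀ c d : Fin (Module.finrank ℂ H) → ℂ,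
      ⟪∑ j, c j • e j, ∑ j, d j • e j⟫_ℂ = ∑ j, starRingEnd ℂ (c j) * d j := fun c d =>
    e.orthonormal.inner_sum c d Finset.univ
  have hUx : ∀ i, U (∑ j, a i j • e j) = ∑ j, (lam j * a i j) • e j := fun i => by
    rw [map_sum]
    exact Finset.sum_congr rfl fun j _ => by rw [map_smul, he, smul_smul, mul_comm]
  have hd : ∀ i j, starRingEnd ℂ (a i j) * a i j = t j := fun i j => by
    rw [Complex.conj_mul', ha]
    exact_mod_cast congrArg (fun x : ℝ => (x : ℂ)) (Real.sq_sqrt (ht0 j))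
  have hxx : ∀ i i', ⟪∑ j, a i j • e j, ∑ j, a i' j • e j⟫_ℂ = if i = i' then 1 else 0 :=
    fun i i' => by
      rw [hin]
      split_ifs with h
      · subst h
        simp only [hd]
        exact_mod_cast congrArg (fun x : ℝ => (x : ℂ)) ht1
      · rw [← (horth i' i (Ne.symm h)).1]
        exact Finset.sum_congr rfl fun j _ => mul_comm _ _
  refine mem_Lambda_of_orthonormal (x := fun i => ∑ j, a i j • e j)
    (orthonormal_iff_ite.2 hxx) fun i i' => ?_
  rw [hxx, hUx, hin]
  split_ifs with h
  · subst h
    rw [hz, mul_one]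
    exact Finset.sum_congr rfl fun j _ => by rw [← hd i j]; ring
  · rw [mul_zero, ← (horth i' i (Ne.symm h)).2]
    exact Finset.sum_congr rfl fun j _ => mul_comm _ _

/-- A sub-multiset of an injectively enumerated spectrum missing one element. -/
theorem exists_eq_image_ne {n : ℕ} {lam : Fin n → ℂ} (hinj : Function.Injective lam)
    {G : Multiset ℂ} (hG : G ≤ Finset.univ.val.map lam) (hcard : G.card + 1 = n) :
    ∃ i, {w : ℂ | w ∈ G} = lam '' {j | j ≠ i} := by
  have hnd : (Finset.univ.val.map lam).Nodup := Finset.univ.nodup.map hinj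
  obtain ⟨R, hR⟩ := Multiset.le_iff_exists_add.1 hG
  have hRc : R.card = 1 := by
    have := congrArg Multiset.card hR
    simp at this; omega
  obtain ⟨r, rfl⟩ := Multiset.card_eq_one.1 hRc
  have hr : r ∈ Finset.univ.val.map lam := by rw [hR]; simp
  obtain ⟨i, -, rfl⟩ := Multiset.mem_map.1 hr
  rw [hR, Multiset.nodup_add] at hnd
  refine ⟨i, Set.ext fun w => ⟨fun hw => ?_, ?_⟩⟩
  · have hw' : w ∈ Finset.univ.val.map lam := Multiset.mem_of_le hG hw
    obtain ⟨j, -, rfl⟩ := Multiset.mem_map.1 hw'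
    refine ⟨j, ?_, rfl⟩
    rintro rfl
    exact Multiset.disjoint_left.1 hnd.2.2 hw (Multiset.mem_singleton_self _)
  · rintro ⟨j, hj, rfl⟩
    have : lam j ∈ Finset.univ.val.map lam := Multiset.mem_map_of_mem _ (Finset.mem_univ j)
    rw [hR, Multiset.mem_add, Multiset.mem_singleton] at this
    exact this.resolve_right fun h => hj (hinj h)

theorem Lambda_two_subset_Omega {U : H →ₗ[ℂ] H} (hU : U ∈ unitary (H →ₗ[ℂ] H))
    (hs : (spec U).Nodup) (hdim : 2 ≤ Module.finrank ℂ H) : Lambda 2 U ⊆ Omega 2 U := by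
  rintro z ⟨P, hP, hrank, hz⟩ G hG hcard
  obtain ⟨lam, hlam⟩ := exists_enumeration_spec U
  obtain ⟨-, e, he⟩ := exists_eigenbasis hU hs hlam
  obtain ⟨i, hi⟩ := exists_eq_image_ne (injective_of_nodup_spec hs hlam) (hlam ▸ hG) (by omega)
  rw [hi]
  obtain ⟨x, hx0, hxi⟩ : ∃ x : LinearMap.range P, x ≠ 0 ∧ ⟪e i, (x : H)⟫_ℂ = 0 := by
    -- The range of `P` has dimension 2, so it contains a nonzero vector orthogonal to `e i`; its
    -- Rayleigh quotient `z` is a convex combination of the other eigenvalues.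
    set f : LinearMap.range P →ₗ[ℂ] ℂ := (innerₛₗ ℂ (e i)).comp (LinearMap.range P).subtype
    have hf : LinearMap.ker f ≠ ⊥ := by
      apply LinearMap.ker_ne_bot_of_finrank_lt
      rw [hrank, Module.finrank_self]; norm_num
    obtain ⟨x, hx, hx0⟩ := Submodule.exists_mem_ne_zero_of_ne_bot hf
    exact ⟨x, hx0, hx⟩
  obtain ⟨⟨x, y, rfl⟩, hx⟩ : ∃ x' : LinearMap.range P, x' = x := ⟨x, rfl⟩
  subst hx
  set x := P y with hxdef
  have hPx : P x = x := by
    rw [hxdef, ← Module.End.mul_apply, hP.isIdempotentElem.eq]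
  have hx0' : x ≠ 0 := fun h => hx0 (Subtype.ext h)
  have hsym : ∀ u w, ⟪P u, w⟫_ℂ = ⟪u, P w⟫_ℂ := fun u w => by
    rw [← LinearMap.adjoint_inner_right, ← LinearMap.star_eq_adjoint,
      hP.isSelfAdjoint.star_eq]
  have hxU : ⟪x, U x⟫_ℂ = z * ⟪x, x⟫_ℂ := by
    have h1 : P (U x) = z • x := by
      have := LinearMap.congr_fun hz x
      simpa [hPx] using this
    conv_lhs => rw [← hPx, hsym, hPx, h1, inner_smul_right]
  set c : Fin (Module.finrank ℂ H) → ℂ := fun j => ⟪e j, x⟫_ℂ with hc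
  have hxc : x = ∑ j, c j • e j := (e.sum_repr' x).symm
  have hin : ∀ c d : Fin (Module.finrank ℂ H) → ℂ,
      ⟪∑ j, c j • e j, ∑ j, d j • e j⟫_ℂ = ∑ j, starRingEnd ℂ (c j) * d j := fun c d =>
    e.orthonormal.inner_sum c d Finset.univ
  have hxx : ⟪x, x⟫_ℂ = ∑ j, ((‖c j‖ ^ 2 : ℝ) : ℂ) := by
    rw [hxc, hin]
    exact Finset.sum_congr rfl fun j _ => by rw [Complex.conj_mul']; push_cast; rfl
  have hxUx : ⟪x, U x⟫_ℂ = ∑ j, ((‖c j‖ ^ 2 : ℝ) : ℂ) * lam j := by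
    have : U x = ∑ j, (lam j * c j) • e j := by
      conv_lhs => rw [hxc]
      rw [map_sum]
      exact Finset.sum_congr rfl fun j _ => by rw [map_smul, he, smul_smul, mul_comm]
    rw [this]
    conv_lhs => rw [hxc]
    rw [hin]
    exact Finset.sum_congr rfl fun j _ => by
      push_cast; rw [← Complex.conj_mul']; ring
  have hpos : 0 < ∑ j, ‖c j‖ ^ 2 := by
    refine lt_of_le_of_ne (Finset.sum_nonneg fun j _ => sq_nonneg _) fun h => hx0' ?_
    rw [← inner_self_eq_zero (𝕜 := ℂ), hxx, ← Complex.ofReal_sum, ← h, Complex.ofReal_zero]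
  set m := ∑ j, ‖c j‖ ^ 2 with hm
  have hz' : z = ∑ j, (‖c j‖ ^ 2 / m) • lam j := by
    have hmc : (m : ℂ) ≠ 0 := Complex.ofReal_ne_zero.2 hpos.ne'
    rw [hxUx, hxx, ← Complex.ofReal_sum, ← hm] at hxU
    rw [eq_div_of_mul_eq hmc hxU.symm, Finset.sum_div]
    exact Finset.sum_congr rfl fun j _ => by rw [Complex.real_smul]; push_cast; ring
  have hci : c i = 0 := hxi
  rw [hz', ← Finset.sum_erase Finset.univ (a := i) (by simp [hci])]
  refine (convex_convexHull ℝ _).sum_mem (fun j _ => by positivity) ?_ fun j hj =>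
    subset_convexHull ℝ _ ⟨j, Finset.ne_of_mem_erase hj, rfl⟩
  rw [Finset.sum_erase Finset.univ (a := i) (by simp [hci]), ← Finset.sum_div, ← hm,
    div_self hpos.ne']

/-- Here `n` is a variable, so that the equality can be substituted; `Module.finrank ℂ H` itself
cannot be. -/
theorem exists_sigma_data_of_eq_five {n : ℕ} (hn : n = 5) {lam : Fin n → ℂ}
    (hinj : Function.Injective lam) (hlam : ∀ j, ‖lam j‖ = 1) {z : ℂ}
    (hz : ∀ i, z ∈ convexHull ℝ (lam '' {j | j ≠ i})) :
    ∃ t : Fin n → ℝ, (∀ j, 0 ≤ t j) ∧ ∑ j, t j = 1 ∧ z = ∑ j, (t j : ℂ) * lam j ∧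
      ∃ a : Fin 2 → Fin n → ℂ, (∀ i j, ‖a i j‖ = Real.sqrt (t j)) ∧
        ∀ i i', i ≠ i' → ∑ j, a i j * starRingEnd ℂ (a i' j) = 0 ∧
          ∑ j, lam j * a i j * starRingEnd ℂ (a i' j) = 0 := by
  subst hn
  exact exists_sigma_data hinj hlam hz

theorem Omega_two_subset_SigmaSet {U : H →ₗ[ℂ] H} (hU : U ∈ unitary (H →ₗ[ℂ] H))
    (hs : (spec U).Nodup) (hdim : Module.finrank ℂ H = 5) : Omega 2 U ⊆ SigmaSet 2 U := by
  intro z hz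
  obtain ⟨lam, hlam⟩ := exists_enumeration_spec U
  have hinj := injective_of_nodup_spec hs hlam
  obtain ⟨hl1, -⟩ := exists_eigenbasis hU hs hlam
  have hz' : ∀ i, z ∈ convexHull ℝ (lam '' {j | j ≠ i}) := fun i => by
    have h := hz ((Finset.univ.erase i).val.map lam) (by
      rw [← hlam]
      exact Multiset.map_le_map (Finset.val_le_iff.2 (Finset.erase_subset _ _))) (by
      simp [hdim])
    convert h using 2
    ext w
    rw [Set.mem_ofPred_eq, Multiset.mem_map]
    simp only [Set.mem_image, Set.mem_ofPred_eq, Finset.mem_val, Finset.mem_erase,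
      Finset.mem_univ, and_true]
  refine ⟨?_, lam, hlam, exists_sigma_data_of_eq_five hdim hinj hl1 hz'⟩
  refine convexHull_mono ?_ (hz' ⟨0, by omega⟩)
  rintro _ ⟨j, -, rfl⟩
  rw [Set.mem_ofPred_eq, ← hlam]
  exact Multiset.mem_map_of_mem _ (Finset.mem_univ j)

end

end HigherRank

theorem theorem6p3 :
    (∀ (H : Type u) [NormedAddCommGroup H] [InnerProductSpace ℂ H] [FiniteDimensional ℂ H],
      Module.finrank ℂ H = 5 →
      ∀ U : H →ₗ[ℂ] H, U ∈ unitary (H →ₗ[ℂ] H) → (HigherRank.spec U).Nodup →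
        HigherRank.Omega 2 U = HigherRank.SigmaSet 2 U ∧
        HigherRank.Lambda 2 U = HigherRank.Omega 2 U) ∧
    HigherRank.Conj.{u} 5 2 := by
  have main : ∀ (H : Type u) [NormedAddCommGroup H] [InnerProductSpace ℂ H]
      [FiniteDimensional ℂ H], Module.finrank ℂ H = 5 →
      ∀ U : H →ₗ[ℂ] H, U ∈ unitary (H →ₗ[ℂ] H) → (HigherRank.spec U).Nodup →
        HigherRank.Omega 2 U = HigherRank.SigmaSet 2 U ∧
        HigherRank.Lambda 2 U = HigherRank.Omega 2 U := by
    intro H _ _ _ hdim U hU hs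
    have h1 := HigherRank.SigmaSet_subset_Lambda hU hs 2
    have h2 := HigherRank.Lambda_two_subset_Omega hU hs (by omega)
    have h3 := HigherRank.Omega_two_subset_SigmaSet hU hs hdim
    exact ⟨h3.antisymm (h1.trans h2), h2.antisymm (h3.trans h1)⟩
  exact ⟨main, fun H _ _ _ hdim U hU hs => (main H hdim U hU hs).2⟩
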